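/- **Theorem.** Let $d\ge 0$, let $\mathcal Z\subset\{0,1\}^d$, and identify each $z\in\mathcal Z$ with the set $\{i\in[d]: z_i=1\}$. Assume that for every $i\in[d]$ there are $z,z'\in\mathcal Z$ with $i\in z$ and $i\notin z'$. In the combinatorial bandit with parameter $\theta\in\mathbb R^d$, an algorithm $\mathcal A$ selects in each round $t$ an index $I_t\in[d]$ (pulls $e_{I_t}$) as a measurable function of the past pulls and observations (and possibly of an independent internal random seed), and observes $Y_t=\theta_{I_t}+\eta_t$, where the $\eta_t$ are i.i.d. $N(0,\sigma^2)$ with $\sigma^2>0$. It stops at a (possibly infinite) stopping time $\tau$ of the observed history and the seed, and then recommends some $\widehat z\in\mathcal Z$. For $\Theta\subset\mathbb R^d$ let $\Theta_{1}$ be the set of $\theta'\in\Theta$ for which $\operatorname{argmax}_{z\in\mathcal Z}\langle z,\theta'\rangle$ is a single item $z_*(\theta')$. The algorithm is $\delta$-PAC for $\Theta$ if $\mathbb P_{\theta'}(\tau<\infty,\ \widehat z=z_*(\theta'))\ge 1-\delta$ for all $\theta'\in\Theta_{1}$. Let $\delta\in(0,1/4)$, let $\theta\in\Theta_{1}$,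 and write $z_*=z_*(\theta)$ and $\Delta_z=\langle z_*-z,\theta\rangle$. Suppose that for every $i\in[d]$: * if $i\in z_*$, then $\theta-s\,e_i\in\overline{\Theta_{1}}$ for some $s>\min_{z\in\mathcal Z:\, i\in z_*\setminus z}\Delta_z$; * if $i\notin z_*$, then $\theta+s\,e_i\in\overline{\Theta_{1}}$ for some $s>\min_{z\in\mathcal Z:\, i\in z\setminus z_*}\Delta_z$. (Here $\overline{\Theta_1}$ is the closure of $\Theta_1$ in $\mathbb R^d$. The condition holds, for instance, if these perturbed vectors belong to $\Theta$ and have a unique best item, and it always holds for $\Theta=\mathbb R^d$.) If $\mathcal A$ is $\delta$-PAC for $\Theta$ and $T_i$ denotes the number of times that $\mathcal A$ pulls $e_i$ before it stops, then $$\mathbb E_\theta\Big[\sum_{i=1}^d T_i\Big]\ \ge\ \frac d2 ,$$ where the expectation may be $+\infty$. -/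

import Mathlib

open MeasureTheory ProbabilityTheory
open scoped ENNReal NNReal

noncomputable section

namespace CombBandit

/-! Combinatorial bandits: the measurement vectors are `e_1, …, e_d`, so a measurement is an index
in `Fin d`, and a vector `z ∈ {0,1}^d` is identified with the set of its nonzero coordinates. -/

/-- The value `⟨z, θ⟩` of an item. -/
def value {d : ℕ} (θ : Fin d → ℝ) (z : Finset (Fin d)) : ℝ := ∑ i ∈ z, θ i

/-- `argmax_{z ∈ Z} ⟨z, θ⟩ = {z}`. -/
def IsUniqueBest {d : ℕ} (Z : Finset (Finset (Fin d))) (θ : Fin d → ℝ)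
    (z : Finset (Fin d)) : Prop :=
  z ∈ Z ∧ ∀ z' ∈ Z, z' ≠ z → value θ z' < value θ z

/-- The gap `Δ_z = ⟨z_* - z, θ⟩`. -/
def gap {d : ℕ} (θ : Fin d → ℝ) (zs z : Finset (Fin d)) : ℝ := value θ zs - value θ z

/-- `min_{z ∈ Z, i ∈ z_* \ z} Δ_z`, for `i ∈ z_*`. -/
def minGapWithout {d : ℕ} (Z : Finset (Finset (Fin d))) (θ : Fin d → ℝ) (zs : Finset (Fin d))
    (i : Fin d) : ℝ :=
  sInf (gap θ zs '' {z | z ∈ Z ∧ i ∈ zs \ z})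

/-- `min_{z ∈ Z, i ∈ z \ z_*} Δ_z`, for `i ∉ z_*`. -/
def minGapWith {d : ℕ} (Z : Finset (Finset (Fin d))) (θ : Fin d → ℝ) (zs : Finset (Fin d))
    (i : Fin d) : ℝ :=
  sInf (gap θ zs '' {z | z ∈ Z ∧ i ∈ z \ zs})

/-- The parameters in `Θ` for which the best item is unique. -/
def uniqueInstances {d : ℕ} (Z : Finset (Finset (Fin d))) (Θ : Set (Fin d → ℝ)) :
    Set (Fin d → ℝ) :=
  {θ | θ ∈ Θ ∧ ∃ z, IsUniqueBest Z θ z}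

/-- The history of the first `t` rounds: the pairs (measurement, observation). -/
abbrev History (d t : ℕ) : Type := Fin t → Fin d × ℝ

/-- A sequential algorithm: a sampling rule, a stopping rule and a recommendation rule, each a
measurable function of the past observations and of an internal random seed in `U` (for an
algorithm without internal randomization, `U` is a one-point space). -/
structure Algorithm (d : ℕ) (Z : Finset (Finset (Fin d))) (U : Type*) [MeasurableSpace U] where
  /-- the measurement chosen after `t` rounds -/
  sample : (t : ℕ) → U × History d t → Fin d
  measurable_sample : ∀ t, Measurable (sample t)
  /-- the seeds and histories on which the algorithm stops after `t` rounds -/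
  halt : (t : ℕ) → Set (U × History d t)
  measurableSet_halt : ∀ t, MeasurableSet (halt t)
  /-- the item recommended if the algorithm stops after `t` rounds -/
  recommend : (t : ℕ) → U × History d t → Finset (Fin d)
  measurableSet_recommend : ∀ t z, MeasurableSet {p | recommend t p = z}
  recommend_mem : ∀ t p, recommend t p ∈ Z

/-- The law of the seed and of the independent `N(0, v)` noise variables. -/
def seedNoise {U : Type*} [MeasurableSpace U] (ρ : Measure U) (v : ℝ≥0) :
    Measure (U × (ℕ → ℝ)) :=
  ρ.prod (Measure.infinitePi fun _ : ℕ => gaussianReal 0 v)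

namespace Algorithm

variable {d : ℕ} {Z : Finset (Finset (Fin d))} {U : Type*} [MeasurableSpace U]

/-- The history of the first `t` rounds on the instance `θ`: pulling `e_x` in the round with
noise `η` gives the observation `θ_x + η`. -/
def history (A : Algorithm d Z U) (θ : Fin d → ℝ) (ω : U × (ℕ → ℝ)) : (t : ℕ) → History d t
  | 0 => Fin.elim0
  | t + 1 =>
    let h := history A θ ω t
    Fin.snoc (α := fun _ => Fin d × ℝ) h
      (A.sample t (ω.1, h), θ (A.sample t (ω.1, h)) + ω.2 t)

/-- The measurement that the sampling rule selects after `t` rounds. -/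
def arm (A : Algorithm d Z U) (θ : Fin d → ℝ) (ω : U × (ℕ → ℝ)) (t : ℕ) : Fin d :=
  A.sample t (ω.1, A.history θ ω t)

/-- The stopping time `τ`, with value `⊤` if the algorithm never stops. -/
def stoppingTime (A : Algorithm d Z U) (θ : Fin d → ℝ) (ω : U × (ℕ → ℝ)) : ℕ∞ :=
  ⨅ (t : ℕ) (_ : (ω.1, A.history θ ω t) ∈ A.halt t), (t : ℕ∞)

/-- The event that the algorithm stops and recommends `z`. -/
def recommends (A : Algorithm d Z U) (θ : Fin d → ℝ) (z : Finset (Fin d)) :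
    Set (U × (ℕ → ℝ)) :=
  {ω | ∃ t : ℕ, A.stoppingTime θ ω = t ∧ A.recommend t (ω.1, A.history θ ω t) = z}

/-- `T_i`, the number of pulls of `e_i` before the algorithm stops. -/
def pulls (A : Algorithm d Z U) (θ : Fin d → ℝ) (i : Fin d) (ω : U × (ℕ → ℝ)) : ℕ∞ :=
  Set.encard {t : ℕ | (t : ℕ∞) < A.stoppingTime θ ω ∧ A.arm θ ω t = i}

/-- The algorithm is `δ`-PAC for `Θ`: on every instance of `Θ` with a unique best item, it stops
and recommends this item with probability at least `1 - δ`. -/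
def IsPAC (A : Algorithm d Z U) (ρ : Measure U) (v : ℝ≥0) (Θ : Set (Fin d → ℝ)) (δ : ℝ) : Prop :=
  ∀ θ ∈ Θ, ∀ z, IsUniqueBest Z θ z →
    ENNReal.ofReal (1 - δ) ≤ seedNoise ρ v (A.recommends θ z)

end Algorithm

end CombBandit

end

/-! If `e_i` is never pulled, then the run does not change when `θ` is replaced by an instance `θ'`
that differs from it only in the coordinate `i`. If `z_*` is not optimal on `θ'`, then a `δ`-PAC
algorithm recommends it there with probability at most `δ`. Hence on `θ`, where `z_*` is recommended
with probability at least `1 - δ`, this happens without a pull of `e_i` with probability at most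
`δ`, and `e_i` is pulled with probability at least `1 - 2δ`.

The instance `θ'` is only a limit of instances on which the PAC property is available. The bound by
`δ` passes to the limit because the probability of recommending `z_*` is lower semicontinuous in the
instance: likelihood ratios express it as an integral, against one fixed measure, of nonnegative
functions that are continuous in the instance, so that Fatou's lemma applies. -/

namespace CombBandit

theorem lowerSemicontinuous_lintegral {X α : Type*} [TopologicalSpace X]
    [FirstCountableTopology X] [MeasurableSpace α] {μ : Measure α} {f : X → α → ℝ≥0∞}
    (hf : ∀ x, Measurable (f x)) (hcont : ∀ a, LowerSemicontinuous fun x => f x a) :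
    LowerSemicontinuous fun x => ∫⁻ a, f x a ∂μ :=
  lowerSemicontinuous_iff_le_liminf.2 fun x =>
    (lintegral_mono fun a => (hcont a).le_liminf x).trans (lintegral_liminf_le hf)

theorem lintegral_gaussianReal_eq_lintegral_add (m : ℝ) (v : ℝ≥0) {f : ℝ → ℝ≥0∞}
    (hf : Measurable f) :
    ∫⁻ y, f y ∂gaussianReal m v = ∫⁻ y, f (m + y) ∂gaussianReal 0 v := by
  rw [← lintegral_map hf (measurable_const_add m), gaussianReal_map_const_add, zero_add]

theorem gaussianReal_eq_withDensity_gaussianReal (m₀ m : ℝ) {v : ℝ≥0} (hv : v ≠ 0) :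
    gaussianReal m v = (gaussianReal m₀ v).withDensity fun y =>
      ENNReal.ofReal (gaussianPDFReal m v y / gaussianPDFReal m₀ v y) := by
  rw [gaussianReal_of_var_ne_zero m hv, gaussianReal_of_var_ne_zero m₀ hv,
    ← withDensity_mul _ (by fun_prop) (by fun_prop)]
  congr 1 with y
  rw [Pi.mul_apply, gaussianPDF, gaussianPDF, ← ENNReal.ofReal_mul (gaussianPDFReal_nonneg _ _ _),
    mul_div_cancel₀ _ (gaussianPDFReal_pos m₀ v y hv).ne']

section Gap

variable {d : ℕ} {Z : Finset (Finset (Fin d))} {θ : Fin d → ℝ} {zs : Finset (Fin d)} {i : Fin d}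
  {s : ℝ}

theorem continuous_gap (zs z : Finset (Fin d)) : Continuous fun θ => gap θ zs z := by
  unfold gap value
  fun_prop

theorem gap_add_single (θ : Fin d → ℝ) (i : Fin d) (s : ℝ) (zs z : Finset (Fin d)) :
    gap (θ + Pi.single i s) zs z =
      gap θ zs z + ((if i ∈ zs then s else 0) - if i ∈ z then s else 0) := by
  simp only [gap, value, Pi.add_apply, Finset.sum_add_distrib, Finset.sum_pi_single']
  ring

theorem exists_gap_sub_single_neg (hZ : ∃ z ∈ Z, i ∉ z) (hi : i ∈ zs)
    (hs : minGapWithout Z θ zs i < s) : ∃ z ∈ Z, gap (θ - Pi.single i s) zs z < 0 := by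
  obtain ⟨z₀, hz₀, hiz₀⟩ := hZ
  have hne : {z | z ∈ Z ∧ i ∈ zs \ z}.Nonempty := ⟨z₀, hz₀, Finset.mem_sdiff.2 ⟨hi, hiz₀⟩⟩
  obtain ⟨_, ⟨z, ⟨hz, hiz⟩, rfl⟩, hlt⟩ := exists_lt_of_csInf_lt (hne.image (gap θ zs)) hs
  refine ⟨z, hz, ?_⟩
  rw [sub_eq_add_neg, ← Pi.single_neg, gap_add_single, if_pos hi,
    if_neg (Finset.mem_sdiff.1 hiz).2]
  linarith

theorem exists_gap_add_single_neg (hZ : ∃ z ∈ Z, i ∈ z) (hi : i ∉ zs)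
    (hs : minGapWith Z θ zs i < s) : ∃ z ∈ Z, gap (θ + Pi.single i s) zs z < 0 := by
  obtain ⟨z₀, hz₀, hiz₀⟩ := hZ
  have hne : {z | z ∈ Z ∧ i ∈ z \ zs}.Nonempty := ⟨z₀, hz₀, Finset.mem_sdiff.2 ⟨hiz₀, hi⟩⟩
  obtain ⟨_, ⟨z, ⟨hz, hiz⟩, rfl⟩, hlt⟩ := exists_lt_of_csInf_lt (hne.image (gap θ zs)) hs
  refine ⟨z, hz, ?_⟩
  rw [gap_add_single, if_neg hi, if_pos (Finset.mem_sdiff.1 hiz).1]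
  linarith

theorem IsUniqueBest.ne_of_gap_neg {z z' : Finset (Fin d)} (hz' : IsUniqueBest Z θ z')
    (hz : z ∈ Z) (hlt : gap θ zs z < 0) : z' ≠ zs := by
  rintro rfl
  have hlt : value θ z' < value θ z := sub_neg.1 hlt
  exact lt_asymm hlt (hz'.2 z hz fun h => hlt.ne (h ▸ rfl))

end Gap

instance isProbabilityMeasure_seedNoise {U : Type*} [MeasurableSpace U] (ρ : Measure U)
    [IsProbabilityMeasure ρ] (v : ℝ≥0) : IsProbabilityMeasure (seedNoise ρ v) := by
  unfold seedNoise
  infer_instance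

/-- The likelihood ratio of a history under the instance `θ` against the instance `θ₀`. It contains
no factors for the sampling rule, which is the same function of the past on both instances. -/
noncomputable def likelihoodRatio {d : ℕ} (v : ℝ≥0) (θ₀ θ : Fin d → ℝ) {t : ℕ}
    (h : History d t) : ℝ≥0∞ :=
  ∏ s, ENNReal.ofReal
    (gaussianPDFReal (θ (h s).1) v (h s).2 / gaussianPDFReal (θ₀ (h s).1) v (h s).2)

section LikelihoodRatio

variable {d t : ℕ} (v : ℝ≥0)

theorem likelihoodRatio_snoc (θ₀ θ : Fin d → ℝ) (h : History d t) (a : Fin d) (y : ℝ) :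
    likelihoodRatio v θ₀ θ (Fin.snoc (α := fun _ => Fin d × ℝ) h (a, y)) =
      likelihoodRatio v θ₀ θ h *
        ENNReal.ofReal (gaussianPDFReal (θ a) v y / gaussianPDFReal (θ₀ a) v y) := by
  simp only [likelihoodRatio, Fin.prod_univ_castSucc, Fin.snoc_castSucc, Fin.snoc_last]

theorem measurable_likelihoodRatio (θ₀ θ : Fin d → ℝ) :
    Measurable fun h : History d t => likelihoodRatio v θ₀ θ h := by
  have hfactor (θ : Fin d → ℝ) (s : Fin t) :
      Measurable fun h : History d t => gaussianPDFReal (θ (h s).1) v (h s).2 := by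
    have hround : Measurable fun h : History d t => h s := measurable_pi_apply s
    have hmean : Measurable fun h : History d t => θ (h s).1 :=
      (measurable_of_finite θ).comp hround.fst
    exact measurable_uncurry_gaussianPDFReal.comp
      (hmean.prodMk (measurable_const.prodMk hround.snd))
  exact Finset.measurable_fun_prod _ fun s _ => ((hfactor θ s).div (hfactor θ₀ s)).ennreal_ofReal

theorem continuous_likelihoodRatio (θ₀ : Fin d → ℝ) (h : History d t) :
    Continuous fun θ => likelihoodRatio v θ₀ θ h := by
  have hofReal (θ : Fin d → ℝ) : likelihoodRatio v θ₀ θ h = ENNReal.ofReal (∏ s,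
      gaussianPDFReal (θ (h s).1) v (h s).2 / gaussianPDFReal (θ₀ (h s).1) v (h s).2) :=
    (ENNReal.ofReal_prod_of_nonneg fun s _ =>
      div_nonneg (gaussianPDFReal_nonneg _ _ _) (gaussianPDFReal_nonneg _ _ _)).symm
  simp only [hofReal, gaussianPDFReal]
  exact ENNReal.continuous_ofReal.comp (by fun_prop)

end LikelihoodRatio

namespace Algorithm

variable {d : ℕ} {Z : Finset (Finset (Fin d))} {U : Type*} [MeasurableSpace U]

section Record

/-- All that the algorithm knows after `t` rounds on the instance `θ`: the seed and the history. -/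
def record (A : Algorithm d Z U) (θ : Fin d → ℝ) (ω : U × (ℕ → ℝ)) (t : ℕ) : U × History d t :=
  (ω.1, A.history θ ω t)

/-- The record after one more round, in which the sampling rule chooses the measurement and `y` is
observed. Unlike `record`, it does not depend on an instance. -/
def observe (A : Algorithm d Z U) {t : ℕ} (p : U × History d t) (y : ℝ) : U × History d (t + 1) :=
  (p.1, Fin.snoc (α := fun _ => Fin d × ℝ) p.2 (A.sample t p, y))

variable (A : Algorithm d Z U)

theorem record_succ (θ : Fin d → ℝ) (ω : U × (ℕ → ℝ)) (t : ℕ) :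
    A.record θ ω (t + 1) = A.observe (A.record θ ω t) (θ (A.arm θ ω t) + ω.2 t) :=
  rfl

theorem measurable_mean (θ : Fin d → ℝ) (t : ℕ) :
    Measurable fun p : U × History d t => θ (A.sample t p) :=
  (measurable_of_finite θ).comp (A.measurable_sample t)

theorem measurable_observe (t : ℕ) :
    Measurable fun q : (U × History d t) × ℝ => A.observe q.1 q.2 := by
  refine measurable_fst.fst.prodMk (measurable_pi_iff.2 (Fin.lastCases ?_ fun j => ?_))
  · simp only [Fin.snoc_last]
    exact ((A.measurable_sample t).comp measurable_fst).prodMk measurable_snd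
  · simp only [Fin.snoc_castSucc]
    exact measurable_fst.snd.eval

theorem measurable_observe_right {t : ℕ} (p : U × History d t) :
    Measurable fun y => A.observe p y :=
  (A.measurable_observe t).comp measurable_prodMk_left

theorem measurable_record_comp {Ω : Type*} [MeasurableSpace Ω] {ξ : Ω → U × (ℕ → ℝ)} {t : ℕ}
    (hseed : Measurable fun x => (ξ x).1) (hnoise : ∀ s < t, Measurable fun x => (ξ x).2 s)
    (θ : Fin d → ℝ) : Measurable fun x => A.record θ (ξ x) t := by
  induction t with
  | zero => exact hseed.prodMk (measurable_pi_iff.2 fun j => j.elim0)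
  | succ t ih =>
    have hrec := ih fun s hs => hnoise s (hs.trans t.lt_succ_self)
    simp only [record_succ]
    exact (A.measurable_observe t).comp
      (hrec.prodMk (((A.measurable_mean θ t).comp hrec).add (hnoise t t.lt_succ_self)))

theorem measurable_record (θ : Fin d → ℝ) (t : ℕ) : Measurable fun ω => A.record θ ω t :=
  A.measurable_record_comp measurable_fst (fun _ _ => measurable_snd.eval) θ

theorem indepFun_record_noise (θ : Fin d → ℝ) (u : U) (t : ℕ) (ν : Measure ℝ)
    [IsProbabilityMeasure ν] :
    IndepFun (fun x : ℕ → ℝ => A.record θ (u, x) t) (fun x => x t)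
      (Measure.infinitePi fun _ : ℕ => ν) := by
  let past : MeasurableSpace (ℕ → ℝ) :=
    ⨆ s ∈ Set.Iio t, MeasurableSpace.comap (fun x => x s) inferInstance
  have hpast : Measurable[past] fun x : ℕ → ℝ => A.record θ (u, x) t :=
    A.measurable_record_comp (ξ := fun x => (u, x)) measurable_const
      (fun s hs => (comap_measurable fun x : ℕ → ℝ => x s).mono
        (le_iSup₂_of_le s hs le_rfl) le_rfl) θ
  have hindep := indep_iSup_of_disjoint (fun s => (measurable_pi_apply s).comap_le)
    (iIndepFun_infinitePi (P := fun _ : ℕ => ν) (X := fun _ x => x) fun _ => measurable_id).iIndep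
    (S := Set.Iio t) (T := {t}) (by simp)
  rw [iSup_singleton] at hindep
  exact (IndepFun_iff_Indep _ _ _).2 (indep_of_indep_of_le_left hindep hpast.comap_le)

theorem measurable_lintegral_observe (θ : Fin d → ℝ) (v : ℝ≥0) {t : ℕ}
    {f : U × History d (t + 1) → ℝ≥0∞} (hf : Measurable f) :
    Measurable fun p => ∫⁻ y, f (A.observe p y) ∂gaussianReal (θ (A.sample t p)) v := by
  have hobs := A.measurable_observe t
  have hmean := A.measurable_mean θ t
  have hshift (p : U × History d t) :=
    lintegral_gaussianReal_eq_lintegral_add (θ (A.sample t p)) v (f := fun y => f (A.observe p y))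
      (hf.comp (A.measurable_observe_right p))
  simp only [hshift]
  exact (hf.comp (hobs.comp (measurable_fst.prodMk
    ((hmean.comp measurable_fst).add measurable_snd)))).lintegral_prod_right'

theorem lintegral_record_succ (ρ : Measure U) (θ : Fin d → ℝ) (v : ℝ≥0) (t : ℕ)
    {f : U × History d (t + 1) → ℝ≥0∞} (hf : Measurable f) :
    ∫⁻ ω, f (A.record θ ω (t + 1)) ∂seedNoise ρ v =
      ∫⁻ ω, ∫⁻ y, f (A.observe (A.record θ ω t) y) ∂gaussianReal (θ (A.arm θ ω t)) v
        ∂seedNoise ρ v := by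
  have hrec := A.measurable_record θ t
  have hmean := A.measurable_mean θ t
  let next (q : (U × History d t) × ℝ) : ℝ≥0∞ :=
    f (A.observe q.1 (θ (A.sample t q.1) + q.2))
  have hnext : Measurable next := hf.comp ((A.measurable_observe t).comp
    (measurable_fst.prodMk ((hmean.comp measurable_fst).add measurable_snd)))
  unfold seedNoise
  refine (lintegral_prod _ (hf.comp (A.measurable_record θ (t + 1))).aemeasurable).trans
    (.trans (lintegral_congr fun u => ?_) (lintegral_prod _
      ((A.measurable_lintegral_observe θ v hf).comp hrec).aemeasurable).symm)
  have hrec_u : Measurable fun x : ℕ → ℝ => A.record θ (u, x) t :=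
    hrec.comp measurable_prodMk_left
  have hlaw := (A.indepFun_record_noise θ u t (gaussianReal 0 v)).map_prod_eq_prod_map_map
    hrec_u.aemeasurable (measurable_pi_apply t).aemeasurable
  rw [Measure.infinitePi_map_eval (fun _ : ℕ => gaussianReal 0 v) t] at hlaw
  calc ∫⁻ x, next (A.record θ (u, x) t, x t) ∂(Measure.infinitePi fun _ => gaussianReal 0 v)
      = ∫⁻ x, ∫⁻ y, next (A.record θ (u, x) t, y) ∂gaussianReal 0 v
          ∂(Measure.infinitePi fun _ => gaussianReal 0 v) := by
        rw [← lintegral_map hnext (hrec_u.prodMk (measurable_pi_apply t)), hlaw,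
          lintegral_prod _ hnext.aemeasurable, lintegral_map hnext.lintegral_prod_right' hrec_u]
    _ = ∫⁻ x, ∫⁻ y, f (A.observe (A.record θ (u, x) t) y)
          ∂gaussianReal (θ (A.arm θ (u, x) t)) v ∂(Measure.infinitePi fun _ => gaussianReal 0 v) :=
        lintegral_congr fun x => (lintegral_gaussianReal_eq_lintegral_add (θ (A.arm θ (u, x) t)) v
          (hf.comp (A.measurable_observe_right (A.record θ (u, x) t)))).symm

theorem lintegral_record_eq_lintegral_likelihoodRatio_mul (ρ : Measure U) (θ₀ θ : Fin d → ℝ)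
    {v : ℝ≥0} (hv : v ≠ 0) (t : ℕ) {f : U × History d t → ℝ≥0∞} (hf : Measurable f) :
    ∫⁻ ω, f (A.record θ ω t) ∂seedNoise ρ v =
      ∫⁻ ω, likelihoodRatio v θ₀ θ (A.history θ₀ ω t) * f (A.record θ₀ ω t) ∂seedNoise ρ v := by
  induction t with
  | zero => simp only [likelihoodRatio, Finset.univ_eq_empty, Finset.prod_empty, one_mul]; rfl
  | succ t ih =>
    have hfy (p : U × History d t) : Measurable fun y => f (A.observe p y) :=
      hf.comp (A.measurable_observe_right p)
    have hround (p : U × History d t) :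
        likelihoodRatio v θ₀ θ p.2 * ∫⁻ y, f (A.observe p y) ∂gaussianReal (θ (A.sample t p)) v =
          ∫⁻ y, likelihoodRatio v θ₀ θ (A.observe p y).2 * f (A.observe p y)
            ∂gaussianReal (θ₀ (A.sample t p)) v := by
      rw [gaussianReal_eq_withDensity_gaussianReal (θ₀ (A.sample t p)) _ hv,
        lintegral_withDensity_eq_lintegral_mul _ (by fun_prop) (hfy p),
        ← lintegral_const_mul _ (.mul (by fun_prop) (hfy p))]
      simp only [observe, likelihoodRatio_snoc, Pi.mul_apply, mul_assoc]
    have hratio : Measurable fun p : U × History d (t + 1) => likelihoodRatio v θ₀ θ p.2 * f p :=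
      ((measurable_likelihoodRatio v θ₀ θ).comp measurable_snd).mul hf
    exact (A.lintegral_record_succ ρ θ v t hf).trans <|
      (ih (A.measurable_lintegral_observe θ v hf)).trans <|
      (lintegral_congr fun ω => hround (A.record θ₀ ω t)).trans
        (A.lintegral_record_succ ρ θ₀ v t hratio).symm

theorem lowerSemicontinuous_measure_record_mem (ρ : Measure U) {v : ℝ≥0} (hv : v ≠ 0) {t : ℕ}
    {S : Set (U × History d t)} (hS : MeasurableSet S) :
    LowerSemicontinuous fun θ => seedNoise ρ v {ω | A.record θ ω t ∈ S} := by
  have hind : Measurable (S.indicator (1 : U × History d t → ℝ≥0∞)) := measurable_one.indicator hS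
  have hmeas (θ : Fin d → ℝ) : seedNoise ρ v {ω | A.record θ ω t ∈ S} =
      ∫⁻ ω, likelihoodRatio v 0 θ (A.history 0 ω t) * S.indicator 1 (A.record 0 ω t)
        ∂seedNoise ρ v :=
    (lintegral_indicator_one (A.measurable_record θ t hS)).symm.trans
      (A.lintegral_record_eq_lintegral_likelihoodRatio_mul ρ 0 θ hv t hind)
  have hrec := A.measurable_record 0 t
  simp only [hmeas]
  refine lowerSemicontinuous_lintegral (fun θ => ?_) fun ω => Continuous.lowerSemicontinuous ?_
  · exact ((measurable_likelihoodRatio v 0 θ).comp hrec.snd).mul (hind.comp hrec)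
  · have hfin : S.indicator (1 : U × History d t → ℝ≥0∞) (A.record 0 ω t) ≠ ∞ :=
      ne_top_of_le_ne_top ENNReal.one_ne_top (Set.indicator_le_self' (fun _ _ => zero_le) _)
    exact (ENNReal.continuous_mul_const hfin).comp (continuous_likelihoodRatio v 0 _)

end Record

section Stopping

variable (A : Algorithm d Z U)

theorem natCast_le_stoppingTime_iff {θ : Fin d → ℝ} {ω : U × (ℕ → ℝ)} {t : ℕ} :
    (t : ℕ∞) ≤ A.stoppingTime θ ω ↔ ∀ s < t, A.record θ ω s ∉ A.halt s := by
  simp only [stoppingTime, le_iInf_iff, Nat.cast_le, record]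
  exact forall_congr' fun s => by rw [← not_le, not_imp_not]

theorem natCast_lt_stoppingTime_iff {θ : Fin d → ℝ} {ω : U × (ℕ → ℝ)} {t : ℕ} :
    (t : ℕ∞) < A.stoppingTime θ ω ↔ ∀ s ≤ t, A.record θ ω s ∉ A.halt s := by
  rw [← ENat.add_one_le_iff (ENat.natCast_ne_top t), ← Nat.cast_succ,
    natCast_le_stoppingTime_iff]
  simp only [Nat.lt_succ_iff]

theorem stoppingTime_eq_natCast_iff {θ : Fin d → ℝ} {ω : U × (ℕ → ℝ)} {t : ℕ} :
    A.stoppingTime θ ω = t ↔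
      A.record θ ω t ∈ A.halt t ∧ ∀ s < t, A.record θ ω s ∉ A.halt s := by
  rw [eq_comm, eq_iff_le_not_lt, natCast_le_stoppingTime_iff, natCast_lt_stoppingTime_iff,
    and_comm]
  refine and_congr_left fun hlt => ?_
  rw [not_iff_comm]
  simp only [Nat.le_iff_lt_or_eq, or_imp, forall_and, forall_eq, and_iff_right hlt]

/-- The records on which the algorithm stops after exactly `t` rounds and recommends `z`; the
truncations of a record to its first `s < t` rounds are the records of the earlier rounds. -/
def stopRecommend (z : Finset (Fin d)) (t : ℕ) : Set (U × History d t) :=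
  {p | (p ∈ A.halt t ∧ ∀ (s : ℕ) (hs : s < t), (p.1, Fin.take s hs.le p.2) ∉ A.halt s) ∧
    A.recommend t p = z}

theorem measurableSet_stopRecommend (z : Finset (Fin d)) (t : ℕ) :
    MeasurableSet (A.stopRecommend z t) := by
  have htake (s : ℕ) (hs : s ≤ t) :
      Measurable fun p : U × History d t => (p.1, Fin.take s hs p.2) :=
    measurable_fst.prodMk (measurable_pi_iff.2 fun _ => measurable_snd.eval)
  refine ((A.measurableSet_halt t).inter ?_).inter (A.measurableSet_recommend t z)
  exact measurableSet_setOfPred.2 <| .forall fun s => .forall fun hs =>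
    measurableSet_setOfPred.1 (htake s hs.le (A.measurableSet_halt s)).compl

theorem take_history (θ : Fin d → ℝ) (ω : U × (ℕ → ℝ)) {s t : ℕ} (h : s ≤ t) :
    Fin.take s h (A.history θ ω t) = A.history θ ω s := by
  induction t, h using Nat.le_induction with
  | base => rfl
  | succ t h ih =>
    rw [← ih, history, ← Fin.take_init s h, Fin.init_snoc]

theorem record_mem_stopRecommend_iff {θ : Fin d → ℝ} {z : Finset (Fin d)} {ω : U × (ℕ → ℝ)}
    {t : ℕ} : A.record θ ω t ∈ A.stopRecommend z t ↔
      A.stoppingTime θ ω = t ∧ A.recommend t (A.record θ ω t) = z := by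
  rw [stoppingTime_eq_natCast_iff]
  simp only [stopRecommend, Set.mem_ofPred_eq, record, take_history]

theorem recommends_eq_iUnion (θ : Fin d → ℝ) (z : Finset (Fin d)) :
    A.recommends θ z = ⋃ t, {ω | A.record θ ω t ∈ A.stopRecommend z t} := by
  ext ω
  simp only [recommends, Set.mem_iUnion, Set.mem_ofPred_eq, record_mem_stopRecommend_iff]
  rfl

theorem measurableSet_recommends (θ : Fin d → ℝ) (z : Finset (Fin d)) :
    MeasurableSet (A.recommends θ z) := by
  rw [recommends_eq_iUnion]
  exact .iUnion fun t => A.measurable_record θ t (A.measurableSet_stopRecommend z t)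

theorem disjoint_recommends (θ : Fin d → ℝ) {z z' : Finset (Fin d)} (h : z ≠ z') :
    Disjoint (A.recommends θ z) (A.recommends θ z') := by
  refine Set.disjoint_left.2 ?_
  rintro ω ⟨t, ht, rfl⟩ ⟨t', ht', rfl⟩
  obtain rfl : t = t' := ENat.natCast_inj.1 (ht.symm.trans ht')
  exact h rfl

theorem lowerSemicontinuous_measure_recommends (ρ : Measure U) {v : ℝ≥0} (hv : v ≠ 0)
    (z : Finset (Fin d)) : LowerSemicontinuous fun θ => seedNoise ρ v (A.recommends θ z) := by
  have hdisj (θ : Fin d → ℝ) :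
      Pairwise (Function.onFun Disjoint fun t => {ω | A.record θ ω t ∈ A.stopRecommend z t}) :=
    fun t t' hne => Set.disjoint_left.2 fun ω h h' => hne (ENat.natCast_inj.1
      ((A.record_mem_stopRecommend_iff.1 h).1.symm.trans (A.record_mem_stopRecommend_iff.1 h').1))
  simp only [recommends_eq_iUnion, measure_iUnion (hdisj _) fun t =>
    A.measurable_record _ t (A.measurableSet_stopRecommend z t)]
  exact lowerSemicontinuous_tsum fun t =>
    A.lowerSemicontinuous_measure_record_mem ρ hv (A.measurableSet_stopRecommend z t)

end Stopping

section Pulls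

variable (A : Algorithm d Z U)

theorem pulls_eq_zero_iff {θ : Fin d → ℝ} {i : Fin d} {ω : U × (ℕ → ℝ)} :
    A.pulls θ i ω = 0 ↔ ∀ t : ℕ, (t : ℕ∞) < A.stoppingTime θ ω → A.arm θ ω t ≠ i := by
  simp only [pulls, Set.encard_eq_zero, Set.eq_empty_iff_forall_notMem, Set.mem_ofPred_eq, not_and]

theorem measurable_pulls (θ : Fin d → ℝ) (i : Fin d) :
    Measurable fun ω => (A.pulls θ i ω : ℝ≥0∞) := by
  let pullAt (t : ℕ) : Set (U × (ℕ → ℝ)) := {ω | (t : ℕ∞) < A.stoppingTime θ ω ∧ A.arm θ ω t = i}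
  have hpullAt (t : ℕ) : MeasurableSet (pullAt t) := by
    simp only [pullAt, natCast_lt_stoppingTime_iff]
    refine .inter (measurableSet_setOfPred.2 (.forall fun s => .forall fun _ => ?_)) ?_
    · exact measurableSet_setOfPred.1 (A.measurable_record θ s (A.measurableSet_halt s)).compl
    · exact (A.measurable_sample t).comp (A.measurable_record θ t) (measurableSet_singleton i)
  have hsum : (fun ω => (A.pulls θ i ω : ℝ≥0∞)) =
      fun ω => ∑' t, (pullAt t).indicator (1 : U × (ℕ → ℝ) → ℝ≥0∞) ω := by
    funext ω
    rw [pulls, ← ENNReal.tsum_set_one, tsum_subtype _ fun _ => (1 : ℝ≥0∞)]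
    rfl
  rw [hsum]
  exact .tsum fun t => measurable_one.indicator (hpullAt t)

theorem history_congr {θ θ' : Fin d → ℝ} {ω : U × (ℕ → ℝ)} {t : ℕ}
    (h : ∀ s < t, θ' (A.arm θ ω s) = θ (A.arm θ ω s)) : A.history θ' ω t = A.history θ ω t := by
  induction t with
  | zero => rfl
  | succ t ih =>
    have hround : θ' (A.sample t (ω.1, A.history θ ω t)) = θ (A.sample t (ω.1, A.history θ ω t)) :=
      h t t.lt_succ_self
    simp only [history, ih fun s hs => h s (hs.trans t.lt_succ_self), hround]

theorem mem_recommends_of_pulls_eq_zero {θ θ' : Fin d → ℝ} {i : Fin d}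
    (hoff : ∀ j ≠ i, θ' j = θ j) {z : Finset (Fin d)} {ω : U × (ℕ → ℝ)}
    (hω : ω ∈ A.recommends θ z) (hi : A.pulls θ i ω = 0) : ω ∈ A.recommends θ' z := by
  rw [recommends_eq_iUnion, Set.mem_iUnion] at hω ⊢
  obtain ⟨t, ht⟩ := hω
  have hτ : A.stoppingTime θ ω = t := (A.record_mem_stopRecommend_iff.1 ht).1
  have hsame : A.history θ' ω t = A.history θ ω t := A.history_congr fun s hs =>
    hoff _ (A.pulls_eq_zero_iff.1 hi s (hτ ▸ Nat.cast_lt.2 hs))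
  refine ⟨t, ?_⟩
  rwa [Set.mem_ofPred_eq, record, hsame]

end Pulls

section PAC

variable {A : Algorithm d Z U} {ρ : Measure U} [IsProbabilityMeasure ρ] {v : ℝ≥0}
  {Θ : Set (Fin d → ℝ)} {δ : ℝ}

theorem IsPAC.nonneg (hA : A.IsPAC ρ v Θ δ) (hΘ : (uniqueInstances Z Θ).Nonempty) : 0 ≤ δ := by
  obtain ⟨θ, hθ, z, hz⟩ := hΘ
  have hle : ENNReal.ofReal (1 - δ) ≤ 1 := (hA θ hθ z hz).trans prob_le_one
  linarith [ENNReal.ofReal_le_one.1 hle]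

theorem IsPAC.measure_recommends_le_of_ne (hA : A.IsPAC ρ v Θ δ) {θ : Fin d → ℝ} (hθ : θ ∈ Θ)
    {z zs : Finset (Fin d)} (hz : IsUniqueBest Z θ z) (hne : z ≠ zs) :
    seedNoise ρ v (A.recommends θ zs) ≤ ENNReal.ofReal δ := by
  have hsum : seedNoise ρ v (A.recommends θ z) + seedNoise ρ v (A.recommends θ zs) ≤ 1 := by
    rw [← measure_union (A.disjoint_recommends θ hne) (A.measurableSet_recommends θ zs)]
    exact prob_le_one
  have hδ : 1 ≤ ENNReal.ofReal (1 - δ) + ENNReal.ofReal δ := by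
    simpa using ENNReal.ofReal_add_le (p := 1 - δ) (q := δ)
  refine (ENNReal.add_le_add_iff_left (a := ENNReal.ofReal (1 - δ)) ENNReal.ofReal_ne_top).1 ?_
  exact ((add_le_add_left (hA θ hθ z hz) _).trans hsum).trans hδ

theorem IsPAC.measure_recommends_le_of_gap_neg (hA : A.IsPAC ρ v Θ δ) (hv : v ≠ 0)
    {θ : Fin d → ℝ} (hθ : θ ∈ closure (uniqueInstances Z Θ)) {zs : Finset (Fin d)}
    (hgap : ∃ z ∈ Z, gap θ zs z < 0) :
    seedNoise ρ v (A.recommends θ zs) ≤ ENNReal.ofReal δ := by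
  obtain ⟨z, hz, hlt⟩ := hgap
  have hopen : IsOpen {θ | gap θ zs z < 0} := isOpen_Iio.preimage (continuous_gap zs z)
  have hclosed : IsClosed {θ | seedNoise ρ v (A.recommends θ zs) ≤ ENNReal.ofReal δ} :=
    (A.lowerSemicontinuous_measure_recommends ρ hv zs).isClosed_preimage _
  refine closure_minimal ?_ hclosed (hopen.inter_closure ⟨hlt, hθ⟩)
  rintro θ' ⟨hlt', hθ', z', hz'⟩
  exact hA.measure_recommends_le_of_ne hθ' hz' (hz'.ne_of_gap_neg hz hlt')

theorem IsPAC.le_lintegral_pulls (hA : A.IsPAC ρ v Θ δ) (hv : v ≠ 0) {θ θ' : Fin d → ℝ}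
    (hθ : θ ∈ Θ) {zs : Finset (Fin d)} (hzs : IsUniqueBest Z θ zs) {i : Fin d}
    (hθ' : θ' ∈ closure (uniqueInstances Z Θ)) (hoff : ∀ j ≠ i, θ' j = θ j)
    (hgap : ∃ z ∈ Z, gap θ' zs z < 0) :
    ENNReal.ofReal (1 - 2 * δ) ≤ ∫⁻ ω, (A.pulls θ i ω : ℝ≥0∞) ∂seedNoise ρ v := by
  have hsub : A.recommends θ zs ⊆ A.recommends θ' zs ∪ {ω | A.pulls θ i ω ≠ 0} := fun ω hω =>
    or_iff_not_imp_right.2 fun hi =>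
      A.mem_recommends_of_pulls_eq_zero hoff hω (not_not.1 hi)
  have hmarkov : seedNoise ρ v {ω | A.pulls θ i ω ≠ 0} ≤
      ∫⁻ ω, (A.pulls θ i ω : ℝ≥0∞) ∂seedNoise ρ v :=
    meas_le_lintegral₀ (A.measurable_pulls θ i).aemeasurable fun ω hω => by
      simpa using ENat.toENNReal_le.2 (Order.one_le_iff_ne_zero.2 hω)
  rw [show 1 - 2 * δ = 1 - δ - δ by ring, ENNReal.ofReal_sub _ (hA.nonneg ⟨θ, hθ, zs, hzs⟩),
    tsub_le_iff_left]
  calc ENNReal.ofReal (1 - δ) ≤ seedNoise ρ v (A.recommends θ zs) := hA θ hθ zs hzs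
    _ ≤ seedNoise ρ v (A.recommends θ' zs) + seedNoise ρ v {ω | A.pulls θ i ω ≠ 0} :=
      (measure_mono hsub).trans (measure_union_le _ _)
    _ ≤ _ := add_le_add (hA.measure_recommends_le_of_gap_neg hv hθ' hgap) hmarkov

end PAC

end Algorithm

end CombBandit

theorem mainTheorem10_general {d : ℕ} (Z : Finset (Finset (Fin d)))
    (hZ : ∀ i : Fin d, (∃ z ∈ Z, i ∈ z) ∧ (∃ z ∈ Z, i ∉ z))
    (v : ℝ≥0) (hv : v ≠ 0) (δ : ℝ)
    (Θ : Set (Fin d → ℝ)) (θ : Fin d → ℝ) (hθ : θ ∈ Θ)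
    (zs : Finset (Fin d)) (hzs : CombBandit.IsUniqueBest Z θ zs)
    (hΘ : ∀ i : Fin d,
      (i ∈ zs ∧ ∃ s : ℝ, CombBandit.minGapWithout Z θ zs i < s ∧
        θ - Pi.single i s ∈ closure (CombBandit.uniqueInstances Z Θ)) ∨
      (i ∉ zs ∧ ∃ s : ℝ, CombBandit.minGapWith Z θ zs i < s ∧
        θ + Pi.single i s ∈ closure (CombBandit.uniqueInstances Z Θ)))
    {U : Type*} [MeasurableSpace U] (ρ : Measure U) [IsProbabilityMeasure ρ]
    (A : CombBandit.Algorithm d Z U) (hA : A.IsPAC ρ v Θ δ) :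
    d * ENNReal.ofReal (1 - 2 * δ) ≤
      ∫⁻ ω, ∑ i : Fin d, ((A.pulls θ i ω : ℕ∞) : ℝ≥0∞) ∂(CombBandit.seedNoise ρ v) := by
  have hpulls (i : Fin d) : ENNReal.ofReal (1 - 2 * δ) ≤
      ∫⁻ ω, (A.pulls θ i ω : ℝ≥0∞) ∂CombBandit.seedNoise ρ v := by
    rcases hΘ i with ⟨hi, s, hs, hcl⟩ | ⟨hi, s, hs, hcl⟩
    · exact hA.le_lintegral_pulls hv hθ hzs hcl (fun j hj => by simp [hj])
        (CombBandit.exists_gap_sub_single_neg (hZ i).2 hi hs)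
    · exact hA.le_lintegral_pulls hv hθ hzs hcl (fun j hj => by simp [hj])
        (CombBandit.exists_gap_add_single_neg (hZ i).1 hi hs)
  rw [lintegral_finsetSum _ fun i _ => A.measurable_pulls θ i]
  simpa using Finset.card_nsmul_le_sum Finset.univ _ _ fun i _ => hpulls i

theorem mainTheorem10 {d : ℕ} (Z : Finset (Finset (Fin d)))
    (hZ : ∀ i : Fin d, (∃ z ∈ Z, i ∈ z) ∧ (∃ z ∈ Z, i ∉ z))
    (v : ℝ≥0) (hv : v ≠ 0) (δ : ℝ) (hδ : 0 < δ) (hδ' : δ < 1 / 4)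
    (Θ : Set (Fin d → ℝ)) (θ : Fin d → ℝ) (hθ : θ ∈ Θ)
    (zs : Finset (Fin d)) (hzs : CombBandit.IsUniqueBest Z θ zs)
    (hΘ : ∀ i : Fin d,
      (i ∈ zs ∧ ∃ s : ℝ, CombBandit.minGapWithout Z θ zs i < s ∧
        θ - Pi.single i s ∈ closure (CombBandit.uniqueInstances Z Θ)) ∨
      (i ∉ zs ∧ ∃ s : ℝ, CombBandit.minGapWith Z θ zs i < s ∧
        θ + Pi.single i s ∈ closure (CombBandit.uniqueInstances Z Θ)))
    {U : Type*} [MeasurableSpace U] (ρ : Measure U) [IsProbabilityMeasure ρ]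
    (A : CombBandit.Algorithm d Z U) (hA : A.IsPAC ρ v Θ δ) :
    (d : ℝ≥0∞) / 2 ≤
      ∫⁻ ω, ∑ i : Fin d, ((A.pulls θ i ω : ℕ∞) : ℝ≥0∞) ∂(CombBandit.seedNoise ρ v) := by
  have hhalf : (2⁻¹ : ℝ≥0∞) ≤ ENNReal.ofReal (1 - 2 * δ) := by
    simpa using ENNReal.ofReal_le_ofReal (show (2⁻¹ : ℝ) ≤ 1 - 2 * δ by linarith)
  exact (mul_le_mul_right hhalf d).trans (mainTheorem10_general Z hZ v hv δ Θ θ hθ zs hzs hΘ ρ A hA)
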